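/- For a probability law $P$ on $\mathbb R$ with $\int|x|^3\,dP(x)<\infty$ let $\mu(P)=\int x\,dP(x)$ be its mean and $\sigma(P)\ge 0$ its standard deviation. Let $\mathcal P_3$ be the set of all such $P$ with $\sigma(P)>0$. For $P\in\mathcal P_3$ let $\widetilde P$ be the image of $P$ under $x\mapsto (x-\mu(P))/\sigma(P)$ and $\varrho(P)=\int |(x-\mu(P))/\sigma(P)|^3\,dP(x)\ (\ge 1)$. Write $Pf=\int f\,dP$, let $\ast$ denote convolution, and for $\varrho\ge 1$ put $$B(\varrho)=\sqrt{\tfrac12\varrho^2+\tfrac12\varrho\sqrt{\varrho^2+8}-2}.$$ For a Banach space $(E,|\cdot|)$ let $\mathcal C^{2,1}(\mathbb R,E)$ be the set of twice continuously differentiable $f:\mathbb R\to E$ with $\|f''\|_{\mathrm L}:=\sup_{x\ne y}|f''(x)-f''(y)|/|x-y|<\infty$. **Theorem.** Let $n\ge 1$, $P_1,\dots,P_n\in\mathcal P_3$, $\sigma_i=\sigma(P_i)$, $\varrho_i=\varrho(P_i)$, $\sigma=(\sum_{i=1}^n\sigma_i^2)^{1/2}$, $Q_i=\frac12(\delta_{-\sigma_i}+\delta_{\sigma_i})$,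 and let $E$ be a Banach space. (a) For every $f\in\mathcal C^{2,1}(\mathbb R,E)$, $f$ is integrable with respect to both standardized convolutions below, and $$\Bigl|\widetilde{P_1\ast\cdots\ast P_n}\,f-\widetilde{Q_1\ast\cdots\ast Q_n}\,f\Bigr|\le\frac{\|f''\|_{\mathrm L}}6\sum_{i=1}^n\frac{\sigma_i^3}{\sigma^3}B(\varrho_i).\qquad(1)$$ (b) If each $P_i$ is a two-point law, if the centred third moments $\int(x-\mu(P_i))^3\,dP_i(x)$ are all $\ge0$ or all $\le0$, and if $f(x)=cx^3$ for $x\in\mathbb R$ with a constant $c\in E$, then $f\in\mathcal C^{2,1}(\mathbb R,E)$ and equality holds in (1). (c) If $\sigma_1=\dots=\sigma_n$, then $\widetilde{Q_1\ast\cdots\ast Q_n}=\widetilde{\mathrm B_{n,1/2}}$, where $\mathrm B_{n,1/2}=(\frac12(\delta_0+\delta_1))^{\ast n}$ is the symmetric binomial law. (d) If $P_1=\dots=P_n=P$, then the right-hand side of (1) equals $\frac{B(\varrho(P))}{6\sqrt n}\|f''\|_{\mathrm L}$; thus for every $f\in\mathcal C^{2,1}(\mathbb R,E)$ $$\Bigl|\widetilde{P^{\ast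 n}}f-\widetilde{\mathrm B_{n,1/2}}f\Bigr|\le\frac{B(\varrho(P))}{6\sqrt n}\,\|f''\|_{\mathrm L},$$ with equality whenever $P$ is a two-point law and $f(x)=cx^3$ for $x\in\mathbb R$ with a constant $c\in E$. -/

import Mathlib

/-!
Standardizing commutes with convolution up to rescaling the summands, so Lindeberg's exchange of
one summand at a time reduces (1) to comparing a single standardized law `ν` with the symmetric
law on `±1`, with the bound `‖f''‖_L / 6 * B(∫ |x|³ dν)`. By Hahn–Banach, `f` may be taken real
valued.

For standardized two-point laws, which live on points `b` and `-1 / b`, the means of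
`± f + ‖f''‖_L / 6 * x³` are monotone in `b`, by the Hermite–Hadamard inequality. This gives the
bound with `|b - 1 / b|`, the absolute value of the third moment, which is `B` of the third absolute
moment. The function `B` is concave. Subtract from `f` the multiple of `|x|³` dictated by the
tangent line of `B` at the third absolute moment of `ν`, and choose `b` maximizing the two-point
mean of the difference. Criticality of `b` says exactly that one parabola touches the difference
to first order at both `b` and `-1 / b`, and the convexity pattern of the derivatives makes this
parabola a majorant. As quadratic functions have the same mean under all standardized laws, this
makes two-point laws extremal for the difference, and for those the bound is the tangent line
inequality for `B`.

For `f(x) = c x³` both sides of (1) are explicit: centred third moments add up under convolution,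
and `σ(P)³ B(ϱ(P))` is the absolute value of the centred third moment of a two-point law `P`.
-/

open MeasureTheory ProbabilityTheory

noncomputable section

namespace RademacherApprox

/-- The mean `μ(P)`. -/
def mean (P : Measure ℝ) : ℝ := ∫ x, x ∂P

/-- The standard deviation `σ(P)`. -/
def sd (P : Measure ℝ) : ℝ := √(Var[id; P])

/-- The class of probability laws on `ℝ` with finite third absolute moment and `σ(P) > 0`. -/
structure IsP3 (P : Measure ℝ) : Prop where
  isProb : IsProbabilityMeasure P
  moment : Integrable (fun x : ℝ => |x| ^ 3) P
  sd_pos : 0 < sd P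

/-- The standardization of `P`: its image under `x ↦ (x - μ(P)) / σ(P)`. -/
def standardize (P : Measure ℝ) : Measure ℝ := P.map (fun x => (x - mean P) / sd P)

/-- The standardized third absolute moment `ϱ(P)`. -/
def rho (P : Measure ℝ) : ℝ := ∫ x, |(x - mean P) / sd P| ^ 3 ∂P

/-- The centred third moment. -/
def centredThird (P : Measure ℝ) : ℝ := ∫ x, (x - mean P) ^ 3 ∂P

/-- The function `B`. -/
def B (r : ℝ) : ℝ := √(r ^ 2 / 2 + r * √(r ^ 2 + 8) / 2 - 2)

/-- The convolution `P₁ ∗ ⋯ ∗ Pₙ`: the image of the product measure under addition. -/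
def convolution {n : ℕ} (P : Fin n → Measure ℝ) : Measure ℝ :=
  (Measure.pi P).map (fun x => ∑ i, x i)

/-- The `n`-th convolution power. -/
def convPow (P : Measure ℝ) (n : ℕ) : Measure ℝ := convolution (fun _ : Fin n => P)

/-- The symmetric two-point law `½ (δ_{-s} + δ_s)`. -/
def symTwoPoint (s : ℝ) : Measure ℝ :=
  (2⁻¹ : ENNReal) • (Measure.dirac (-s) + Measure.dirac s)

/-- The symmetric binomial law `(½ (δ_0 + δ_1))^{∗ n}`. -/
def symBinomial (n : ℕ) : Measure ℝ :=
  convPow ((2⁻¹ : ENNReal) • (Measure.dirac 0 + Measure.dirac 1)) n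

/-- Laws concentrated on two distinct points, both of positive mass. -/
def IsTwoPoint (P : Measure ℝ) : Prop :=
  ∃ a b p : ℝ, a ≠ b ∧ 0 < p ∧ p < 1 ∧
    P = ENNReal.ofReal p • Measure.dirac a + ENNReal.ofReal (1 - p) • Measure.dirac b

section

variable {E : Type*} [NormedAddCommGroup E]

/-- The set of difference quotients of `g` whose supremum is its Lipschitz constant. -/
def lipQuotients (g : ℝ → E) : Set ℝ :=
  {r | ∃ x y : ℝ, x ≠ y ∧ r = ‖g x - g y‖ / |x - y|}

/-- The Lipschitz constant `‖g‖_L`; used only for `g` with `lipQuotients g` bounded. -/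
def lipNorm (g : ℝ → E) : ℝ := sSup (lipQuotients g)

/-- `f ∈ C^{2,1}(ℝ, E)`: twice continuously differentiable with Lipschitz second derivative. -/
def IsC21 [NormedSpace ℝ E] (f : ℝ → E) : Prop :=
  ContDiff ℝ 2 f ∧ BddAbove (lipQuotients (iteratedDeriv 2 f))

end

end RademacherApprox

end

namespace RademacherApprox

open Set Filter Topology
open scoped NNReal

section Calculus

theorem two_mul_sub_le_of_convexOn {G g : ℝ → ℝ} {x y : ℝ}
    (hG : ∀ z ∈ Icc x y, HasDerivAt G (g z) z) (hg : ConvexOn ℝ (Icc x y) g) (hxy : x ≤ y) :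
    2 * (G y - G x) ≤ (g x + g y) * (y - x) := by
  rcases hxy.eq_or_lt with rfl | hxy
  · simp
  -- `(y - x) G` minus the primitive of `(y - x)` times the chord of `g`
  let Φ : ℝ → ℝ := fun z => (y - x) * G z - (g y * (z - x) ^ 2 - g x * (y - z) ^ 2) / 2
  have hΦ : ∀ z ∈ Icc x y,
      HasDerivAt Φ ((y - x) * g z - ((y - z) * g x + (z - x) * g y)) z := fun z hz =>
    (((hG z hz).const_mul (y - x)).sub ((((((hasDerivAt_id z).sub_const x).pow 2).const_mul
      (g y)).sub ((((hasDerivAt_id z).const_sub y).pow 2).const_mul (g x))).div_const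
        2)).congr_deriv (by simp; ring)
  have hanti : AntitoneOn Φ (Icc x y) := by
    refine antitoneOn_of_hasDerivWithinAt_nonpos (convex_Icc x y)
      (fun z hz => (hΦ z hz).continuousAt.continuousWithinAt)
      (fun z hz => (hΦ z (interior_subset hz)).hasDerivWithinAt) fun z hz => ?_
    rw [interior_Icc] at hz
    exact sub_nonpos.2 (hg.secant_mono_aux1 (left_mem_Icc.2 hxy.le) (right_mem_Icc.2 hxy.le)
      hz.1 hz.2)
  have h : Φ y ≤ Φ x := hanti (left_mem_Icc.2 hxy.le) (right_mem_Icc.2 hxy.le) hxy.le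
  refine le_of_mul_le_mul_left ?_ (sub_pos.2 hxy)
  simp only [Φ] at h
  linarith

theorem nonneg_of_double_zeros_of_zero_le {D D' : ℝ → ℝ} (hD : ∀ x, HasDerivAt D (D' x) x)
    (hleft : ConcaveOn ℝ (Iic 0) D') (hright : ConvexOn ℝ (Ici 0) D') {u v w : ℝ}
    (hu : u < 0) (hw : 0 ≤ w) (hwv : w < v) (hDu : D u = 0) (hDv : D v = 0)
    (hDu' : D' u = 0) (hDw' : D' w = 0) (hDv' : D' v = 0) (x : ℝ) : 0 ≤ D x := by
  have hcont (s : Set ℝ) : ContinuousOn D s := fun x _ => (hD x).continuousAt.continuousWithinAt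
  have hderiv (s : Set ℝ) : ∀ x ∈ interior s, HasDerivWithinAt D (D' x) (interior s) x :=
    fun x _ => (hD x).hasDerivWithinAt
  have hv : v ∈ Ici (0 : ℝ) := hw.trans hwv.le
  have nonneg_right {y : ℝ} (hy : 0 ≤ y) (hyw : y ≤ w) : 0 ≤ D' y :=
    hDw'.ge.trans (hright.le_left_of_right_le'' hy hv hyw hwv (hDv'.trans hDw'.symm).le)
  have nonneg_zero : 0 ≤ D' 0 := nonneg_right le_rfl hw
  have h₁ : ∀ y ∈ interior (Iic u), D' y ≤ 0 := fun y hy =>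
    (hleft.left_le_of_le_right'' (mem_Iic.2 ((interior_subset hy).out.trans hu.le)) self_mem_Iic
      (interior_subset hy : y ∈ Iic u) hu (hDu'.trans_le nonneg_zero)).trans_eq hDu'
  have h₂ : ∀ y ∈ interior (Icc u w), 0 ≤ D' y := fun y hy => by
    obtain ⟨huy, hyw⟩ := interior_subset hy
    rcases le_total y 0 with hy0 | hy0
    · exact (le_min hDu'.ge nonneg_zero).trans
        (hleft.min_le_of_mem_Icc hu.le self_mem_Iic ⟨huy, hy0⟩)
    · exact nonneg_right hy0 hyw
  have h₃ : ∀ y ∈ interior (Icc w v), D' y ≤ 0 := fun y hy =>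
    (hright.le_max_of_mem_Icc hw hv (interior_subset hy)).trans (max_le hDw'.le hDv'.le)
  have h₄ : ∀ y ∈ interior (Ici v), 0 ≤ D' y := fun y hy =>
    hDv'.ge.trans (hright.le_right_of_left_le'' hw (hv.trans (interior_subset hy).out) hwv
      (interior_subset hy : y ∈ Ici v) (hDw'.trans hDv'.symm).le)
  rcases le_total x u with hxu | hux
  · exact hDu ▸ antitoneOn_of_hasDerivWithinAt_nonpos (convex_Iic u) (hcont _) (hderiv _) h₁
      hxu self_mem_Iic hxu
  rcases le_total x w with hxw | hwx
  · exact hDu ▸ monotoneOn_of_hasDerivWithinAt_nonneg (convex_Icc u w) (hcont _) (hderiv _) h₂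
      (left_mem_Icc.2 (hux.trans hxw)) ⟨hux, hxw⟩ hux
  rcases le_total x v with hxv | hvx
  · exact hDv ▸ antitoneOn_of_hasDerivWithinAt_nonpos (convex_Icc w v) (hcont _) (hderiv _) h₃
      ⟨hwx, hxv⟩ (right_mem_Icc.2 hwv.le) hxv
  · exact hDv ▸ monotoneOn_of_hasDerivWithinAt_nonneg (convex_Ici v) (hcont _) (hderiv _) h₄
      self_mem_Ici hvx hvx

theorem nonneg_of_double_zeros {D D' : ℝ → ℝ} (hD : ∀ x, HasDerivAt D (D' x) x)
    (hleft : ConcaveOn ℝ (Iic 0) D') (hright : ConvexOn ℝ (Ici 0) D') {u v : ℝ}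
    (hu : u < 0) (hv : 0 < v) (hDu : D u = 0) (hDv : D v = 0)
    (hDu' : D' u = 0) (hDv' : D' v = 0) (x : ℝ) : 0 ≤ D x := by
  obtain ⟨w, hw, hDw'⟩ := exists_hasDerivAt_eq_zero (hu.trans hv)
    (fun x _ => (hD x).continuousAt.continuousWithinAt) (hDu.trans hDv.symm) fun x _ => hD x
  rcases le_total 0 w with hw0 | hw0
  · exact nonneg_of_double_zeros_of_zero_le hD hleft hright hu hw0 hw.2 hDu hDv hDu' hDw' hDv' x
  · have hD_neg : ∀ x, HasDerivAt (fun x => D (-x)) (-D' (-x)) x := fun x =>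
      ((hD (-x)).scomp x (hasDerivAt_neg x)).congr_deriv (by simp)
    have hleft_neg : ConcaveOn ℝ (Iic 0) fun x => -D' (-x) := by
      have := hright.neg.comp_linearMap (-LinearMap.id)
      rwa [show ⇑(-LinearMap.id : ℝ →ₗ[ℝ] ℝ) ⁻¹' Ici 0 = Iic 0 by ext; simp] at this
    have hright_neg : ConvexOn ℝ (Ici 0) fun x => -D' (-x) := by
      have := hleft.neg.comp_linearMap (-LinearMap.id)
      rwa [show ⇑(-LinearMap.id : ℝ →ₗ[ℝ] ℝ) ⁻¹' Iic 0 = Ici 0 by ext; simp] at this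
    simpa using nonneg_of_double_zeros_of_zero_le (w := -w) hD_neg hleft_neg hright_neg
      (neg_lt_zero.2 hv) (neg_nonneg.2 hw0) (neg_lt_neg hw.1) (by simpa) (by simpa) (by simpa)
      (by simpa) (by simpa) (-x)

variable {E : Type*} [NormedAddCommGroup E] [NormedSpace ℝ E]

theorem norm_le_of_norm_deriv_le_pow {g g' : ℝ → E} (hg : ∀ x, HasDerivAt g (g' x) x)
    (h0 : g 0 = 0) {C : ℝ} {k : ℕ} (hC : ∀ x, ‖g' x‖ ≤ C * |x| ^ k) (x : ℝ) :
    ‖g x‖ ≤ C / (k + 1) * |x| ^ (k + 1) := by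
  wlog hx : 0 ≤ x generalizing g g' x
  · have hg_neg : ∀ y, HasDerivAt (fun y => g (-y)) (-g' (-y)) y := fun y =>
      ((hg (-y)).scomp y (hasDerivAt_neg y)).congr_deriv (by simp)
    simpa using this hg_neg (by simpa) (fun y => by simpa using hC (-y)) (-x)
      (neg_nonneg.2 (not_le.1 hx).le)
  have hk : (k : ℝ) + 1 ≠ 0 := by positivity
  rw [abs_of_nonneg hx]
  refine image_norm_le_of_norm_deriv_right_le_deriv_boundary (f' := g') (a := 0)
    (B := fun y => C / (k + 1) * y ^ (k + 1)) (B' := fun y => C * y ^ k)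
    (fun y _ => (hg y).continuousAt.continuousWithinAt) (fun y _ => (hg y).hasDerivWithinAt)
    (by simp [h0]) (fun y => ((hasDerivAt_pow (k + 1) y).const_mul _).congr_deriv ?_)
    (fun y hy => ?_) (right_mem_Icc.2 hx)
  · push_cast
    field_simp
  · simpa [abs_of_nonneg hy.1] using hC y

variable {f : ℝ → E} {L : ℝ≥0}

theorem hasDerivAt_deriv_of_contDiff_two (hf : ContDiff ℝ 2 f) (x : ℝ) :
    HasDerivAt (deriv f) (iteratedDeriv 2 f x) x := by
  rw [iteratedDeriv_succ, iteratedDeriv_one]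
  exact ((hf.iterate_deriv' 1 1).differentiable (by simp) x).hasDerivAt

theorem norm_sub_taylor_two_le (hf : ContDiff ℝ 2 f) (hL : LipschitzWith L (iteratedDeriv 2 f))
    (x : ℝ) :
    ‖f x - (f 0 + x • deriv f 0 + (x ^ 2 / 2) • iteratedDeriv 2 f 0)‖ ≤ L / 6 * |x| ^ 3 := by
  have hf₁ : ∀ x, HasDerivAt f (deriv f x) x := fun x =>
    (hf.differentiable (by simp) x).hasDerivAt
  have h₁ := norm_le_of_norm_deriv_le_pow (k := 1)
    (g := fun x => deriv f x - (deriv f 0 + x • iteratedDeriv 2 f 0))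
    (g' := fun x => iteratedDeriv 2 f x - iteratedDeriv 2 f 0)
    (fun x => ((hasDerivAt_deriv_of_contDiff_two hf x).sub
      (((hasDerivAt_id x).smul_const (iteratedDeriv 2 f 0)).const_add _)).congr_deriv (by simp))
    (by simp) fun x => by simpa using hL.norm_sub_le x 0
  have h₂ := norm_le_of_norm_deriv_le_pow (k := 2)
    (g := fun x => f x - (f 0 + x • deriv f 0 + (x ^ 2 / 2) • iteratedDeriv 2 f 0))
    (g' := fun x => deriv f x - (deriv f 0 + x • iteratedDeriv 2 f 0))
    (fun x => ((hf₁ x).sub ((((hasDerivAt_id x).smul_const (deriv f 0)).const_add _).add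
      (((hasDerivAt_pow 2 x).div_const 2).smul_const (iteratedDeriv 2 f 0)))).congr_deriv (by simp))
    (by simp) (C := L / (1 + 1)) fun x => by simpa using h₁ x
  refine (h₂ x).trans_eq ?_
  push_cast
  ring

end Calculus

section TwoPointMean

variable {F F' : ℝ → ℝ} {b : ℝ}

/-- The integral of `F` with respect to the standardized law on the two points `b` and `-1 / b`,
which is how the standardized two-point laws are parametrized by `b > 0`. -/
noncomputable def twoPointMean (F : ℝ → ℝ) (b : ℝ) : ℝ := (F b + b ^ 2 * F (-b⁻¹)) / (1 + b ^ 2)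

/-- Twice the error of the trapezoidal rule for the derivative `F'` of `F` on `[-1 / b, b]`;
up to a positive factor this is the derivative of `twoPointMean F`. -/
noncomputable def trapezoidDefect (F F' : ℝ → ℝ) (b : ℝ) : ℝ :=
  (F' b + F' (-b⁻¹)) * (b + b⁻¹) - 2 * (F b - F (-b⁻¹))

theorem twoPointMean_one (F : ℝ → ℝ) : twoPointMean F 1 = (F 1 + F (-1)) / 2 := by
  simp only [twoPointMean, inv_one]
  norm_num

theorem twoPointMean_neg (F : ℝ → ℝ) (b : ℝ) :
    twoPointMean (fun x => -F x) b = -twoPointMean F b := by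
  simp only [twoPointMean]
  ring

theorem twoPointMean_add_mul_pow_three (F : ℝ → ℝ) (c : ℝ) (hb : b ≠ 0) :
    twoPointMean (fun x => F x + c * x ^ 3) b = twoPointMean F b + c * (b - b⁻¹) := by
  unfold twoPointMean
  field_simp
  ring

theorem hasDerivAt_twoPointMean (hF : ∀ x, HasDerivAt F (F' x) x) (hb : b ≠ 0) :
    HasDerivAt (twoPointMean F) (b / (1 + b ^ 2) ^ 2 * trapezoidDefect F F' b) b := by
  have hinv : HasDerivAt (fun x => F (-x⁻¹)) (F' (-b⁻¹) * (b ^ 2)⁻¹) b :=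
    ((hF (-b⁻¹)).comp b (hasDerivAt_inv hb).neg).congr_deriv (by simp)
  refine (((hF b).add ((hasDerivAt_pow 2 b).mul hinv)).div ((hasDerivAt_pow 2 b).const_add 1)
    (by positivity)).congr_deriv ?_
  simp only [trapezoidDefect]
  field_simp
  norm_num
  ring

theorem monotoneOn_twoPointMean (hF : ∀ x, HasDerivAt F (F' x) x) (hF' : ConvexOn ℝ univ F') :
    MonotoneOn (twoPointMean F) (Ioi 0) := by
  refine monotoneOn_of_hasDerivWithinAt_nonneg (convex_Ioi 0)
    (fun b hb => (hasDerivAt_twoPointMean hF hb.out.ne').continuousAt.continuousWithinAt)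
    (fun b hb => (hasDerivAt_twoPointMean hF (interior_subset hb).out.ne').hasDerivWithinAt)
    fun b hb => ?_
  have hb : 0 < b := interior_subset hb
  have hle : -b⁻¹ ≤ b := by linarith [inv_pos.2 hb]
  have := two_mul_sub_le_of_convexOn (fun z _ => hF z) (hF'.subset (subset_univ _)
    (convex_Icc (-b⁻¹) b)) hle
  exact mul_nonneg (by positivity) (sub_nonneg.2 (this.trans_eq (by ring)))

theorem exists_quadratic_majorant (hF : ∀ x, HasDerivAt F (F' x) x)
    (hleft : ConvexOn ℝ (Iic 0) F') (hright : ConcaveOn ℝ (Ici 0) F') (hb : 0 < b)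
    (hdefect : trapezoidDefect F F' b = 0) :
    ∃ α β γ : ℝ, (∀ x, F x ≤ α + β * x + γ * x ^ 2) ∧ α + γ = twoPointMean F b := by
  obtain ⟨c, hc⟩ : ∃ c, c = b⁻¹ := ⟨_, rfl⟩
  have hc0 : 0 < c := hc ▸ inv_pos.2 hb
  have hbc : b * c = 1 := hc ▸ mul_inv_cancel₀ hb.ne'
  rw [trapezoidDefect, ← hc] at hdefect
  rw [twoPointMean, ← hc]
  -- the parabola touching `F` to first order at `b`; by `hdefect` it also does so at `-b⁻¹`
  obtain ⟨γ, hγ⟩ : ∃ γ, 2 * γ * (b + c) = F' b - F' (-c) :=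
    ⟨(F' b - F' (-c)) / (2 * (b + c)), by field_simp⟩
  let q : ℝ → ℝ := fun x => F b + F' b * (x - b) + γ * (x - b) ^ 2
  let ℓ : ℝ →ₗ[ℝ] ℝ := (2 * γ) • LinearMap.id
  have hq : ∀ x, HasDerivAt q (ℓ x + (F' b - 2 * γ * b)) x := fun x =>
    ((((hasDerivAt_id x).sub_const b).const_mul (F' b)).const_add (F b) |>.add
      ((((hasDerivAt_id x).sub_const b).pow 2).const_mul γ)).congr_deriv (by simp [ℓ]; ring)
  have touch : q (-c) - F (-c) = 0 := by
    simp only [q]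
    linear_combination (b + c) / 2 * hγ - hdefect / 2
  refine ⟨F b - F' b * b + γ * b ^ 2, F' b - 2 * γ * b, γ, fun x => ?_, ?_⟩
  · have := nonneg_of_double_zeros (fun x => (hq x).sub (hF x))
      (((ℓ.concaveOn (convex_Iic 0)).add_const _).sub hleft)
      (((ℓ.convexOn (convex_Ici 0)).add_const _).sub hright)
      (neg_lt_zero.2 hc0) hb touch (by simp [q])
      (by simp [ℓ]; linarith) (by simp [ℓ]) x
    simp only [q, Pi.sub_apply] at this
    linarith
  · rw [eq_div_iff (by positivity)]
    simp only [q] at touch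
    linear_combination b ^ 2 * touch + (F' b * b - γ * (2 * b ^ 2 + 1 + b * c)) * hbc

theorem twoPointMean_le_of_le_cubic {α β γ m : ℝ} (hm : 0 ≤ m)
    (hF : ∀ x, F x ≤ α + β * x + γ * x ^ 2 - m * |x| ^ 3) (hb : 0 < b) :
    twoPointMean F b ≤ α + γ - m * (b + b⁻¹) / 2 := by
  have h₁ := hF b
  have h₂ := mul_le_mul_of_nonneg_left (hF (-b⁻¹)) (sq_nonneg b)
  rw [abs_of_pos hb] at h₁
  rw [abs_neg, abs_of_pos (inv_pos.2 hb)] at h₂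
  have hdiff : m * (b + b⁻¹) / 2 * (1 + b ^ 2) =
      m * (b ^ 3 + b⁻¹) - m * (b⁻¹ * (b ^ 2 - 1) ^ 2) / 2 := by
    field_simp
    ring
  have hnonneg : 0 ≤ m * (b⁻¹ * (b ^ 2 - 1) ^ 2) := by positivity
  have hcancel : b ^ 2 * (α + β * -b⁻¹ + γ * (-b⁻¹) ^ 2 - m * b⁻¹ ^ 3) =
      b ^ 2 * α - β * b + γ - m * b⁻¹ := by
    field_simp
    ring
  rw [twoPointMean, div_le_iff₀ (by positivity)]
  linarith

theorem exists_isMaxOn_twoPointMean (hF : Continuous F) {α β γ m : ℝ} (hm : 0 < m)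
    (hbound : ∀ x, F x ≤ α + β * x + γ * x ^ 2 - m * |x| ^ 3) :
    ∃ b ∈ Ioi 0, IsMaxOn (twoPointMean F) (Ioi 0) b := by
  let K := max 1 (2 * (α + γ - twoPointMean F 1) / m)
  have hK : 1 ≤ K := le_max_left _ _
  have hK' : α + γ - m * K / 2 ≤ twoPointMean F 1 := by
    have := (div_le_iff₀ hm).1 (le_max_right 1 (2 * (α + γ - twoPointMean F 1) / m))
    linarith
  have hK0 : 0 < K⁻¹ := by positivity
  have hcont : ContinuousOn (twoPointMean F) (Icc K⁻¹ K) := by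
    have hne : ∀ b ∈ Icc K⁻¹ K, b ≠ 0 := fun b hb => (hK0.trans_le hb.1).ne'
    unfold twoPointMean
    exact ((hF.continuousOn).add ((continuousOn_pow 2).mul
      (hF.comp_continuousOn (continuousOn_id.inv₀ hne).neg))).div (by fun_prop)
        fun b _ => by positivity
  have hone : (1 : ℝ) ∈ Icc K⁻¹ K := ⟨inv_le_one_of_one_le₀ hK, hK⟩
  obtain ⟨b, hb, hmax⟩ := isCompact_Icc.exists_isMaxOn ⟨1, hone⟩ hcont
  refine ⟨b, hK0.trans_le hb.1, fun x hx => ?_⟩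
  by_cases hxK : x ∈ Icc K⁻¹ K
  · exact hmax hxK
  have hx : 0 < x := hx
  have hlarge : K ≤ x + x⁻¹ := by
    have hxi := inv_pos.2 hx
    rcases lt_or_ge x K⁻¹ with h | h
    · linarith [(lt_inv_comm₀ hx (by positivity)).1 h]
    · linarith [not_le.1 fun h' => hxK ⟨h, h'⟩]
  calc twoPointMean F x ≤ α + γ - m * (x + x⁻¹) / 2 := twoPointMean_le_of_le_cubic hm.le hbound hx
    _ ≤ α + γ - m * K / 2 := by gcongr
    _ ≤ twoPointMean F 1 := hK'
    _ ≤ twoPointMean F b := hmax hone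

theorem exists_integral_le_twoPointMean (hF : ∀ x, HasDerivAt F (F' x) x)
    (hleft : ConvexOn ℝ (Iic 0) F') (hright : ConcaveOn ℝ (Ici 0) F') {α β γ m : ℝ} (hm : 0 < m)
    (hbound : ∀ x, F x ≤ α + β * x + γ * x ^ 2 - m * |x| ^ 3) :
    ∃ b, 0 < b ∧ ∀ ν : Measure ℝ, IsProbabilityMeasure ν → Integrable F ν → MemLp id 2 ν →
      ∫ x, x ∂ν = 0 → ∫ x, x ^ 2 ∂ν = 1 → ∫ x, F x ∂ν ≤ twoPointMean F b := by
  have hcont : Continuous F := continuous_iff_continuousAt.2 fun x => (hF x).continuousAt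
  obtain ⟨b, hb, hmax⟩ := exists_isMaxOn_twoPointMean hcont hm hbound
  have hb : 0 < b := hb
  have hdefect : trapezoidDefect F F' b = 0 :=
    (mul_eq_zero.1 ((hmax.isLocalMax (Ioi_mem_nhds hb)).hasDerivAt_eq_zero
      (hasDerivAt_twoPointMean hF hb.ne'))).resolve_left (by positivity)
  obtain ⟨α', β', γ', hle, hval⟩ := exists_quadratic_majorant hF hleft hright hb hdefect
  refine ⟨b, hb, fun ν _ hFν hν hmean hvar => ?_⟩
  have h₁ : Integrable (fun x : ℝ => x) ν := hν.integrable (by norm_num)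
  have h₀₁ : Integrable (fun x : ℝ => α' + β' * x) ν := (integrable_const _).add (h₁.const_mul _)
  have h₂ : Integrable (fun x : ℝ => x ^ 2) ν := hν.integrable_sq
  calc ∫ x, F x ∂ν ≤ ∫ x, α' + β' * x + γ' * x ^ 2 ∂ν :=
        integral_mono hFν (h₀₁.add (h₂.const_mul _)) hle
    _ = α' + γ' := by
        rw [integral_add h₀₁ (h₂.const_mul _), integral_add (integrable_const _) (h₁.const_mul _),
          integral_const_mul, integral_const_mul, hmean, hvar]
        simp
    _ = twoPointMean F b := hval

end TwoPointMean

section TwoPointRho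

variable {r t T : ℝ}

/-- The third absolute moment of a standardized two-point law, as a function of the absolute value
`t` of its third moment. -/
noncomputable def twoPointRho (t : ℝ) : ℝ := (t ^ 2 + 2) / √(t ^ 2 + 4)

/-- The derivative at `T` of the inverse function of `twoPointRho`. -/
noncomputable def tangentSlope (T : ℝ) : ℝ := √(T ^ 2 + 4) ^ 3 / (T * (T ^ 2 + 6))

theorem twoPointMean_abs_pow_three {b : ℝ} (hb : 0 < b) :
    twoPointMean (fun x => |x| ^ 3) b = twoPointRho |b - b⁻¹| := by
  have hsqrt : √((b - b⁻¹) ^ 2 + 4) = b + b⁻¹ := by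
    rw [show (b - b⁻¹) ^ 2 + 4 = (b + b⁻¹) ^ 2 by field_simp; ring]
    exact Real.sqrt_sq (by positivity)
  rw [twoPointRho, sq_abs, hsqrt, twoPointMean, abs_neg, abs_of_pos hb, abs_of_pos (inv_pos.2 hb)]
  field_simp
  ring

theorem one_lt_tangentSlope (hT : 0 < T) : 1 < tangentSlope T := by
  rw [tangentSlope, one_lt_div (by positivity)]
  refine lt_of_pow_lt_pow_left₀ 2 (by positivity) ?_
  rw [← pow_mul, mul_comm 3 2, pow_mul, Real.sq_sqrt (by positivity)]
  nlinarith [sq_nonneg T]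

theorem le_tangent (ht : 0 ≤ t) (hT : 0 < T) :
    t ≤ T + tangentSlope T * (twoPointRho t - twoPointRho T) := by
  have hs : √(t ^ 2 + 4) ^ 2 = t ^ 2 + 4 := Real.sq_sqrt (by positivity)
  have hS : √(T ^ 2 + 4) ^ 2 = T ^ 2 + 4 := Real.sq_sqrt (by positivity)
  have hs0 : 0 < √(t ^ 2 + 4) := by positivity
  have hS0 : 0 < √(T ^ 2 + 4) := by positivity
  unfold tangentSlope twoPointRho
  generalize √(t ^ 2 + 4) = s at *
  generalize √(T ^ 2 + 4) = S at *
  have key : s * (8 + T * (T ^ 2 + 6) * t) ≤ (t ^ 2 + 2) * S ^ 3 := by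
    -- after squaring, the difference of the two sides has a double root at `t = T`
    refine (sq_le_sq₀ (by positivity) (by positivity)).1 ?_
    calc (s * (8 + T * (T ^ 2 + 6) * t)) ^ 2
        = (t ^ 2 + 4) * (8 + T * (T ^ 2 + 6) * t) ^ 2 := by rw [mul_pow, hs]
      _ ≤ (t ^ 2 + 4) * (8 + T * (T ^ 2 + 6) * t) ^ 2 + (t - T) ^ 2 *
          ((12 * T ^ 2 + 64) * t ^ 2 + (8 * T ^ 3 + 32 * T) * t + 4 * (T ^ 4 + 12 * T ^ 2 + 48)) :=
        le_add_of_nonneg_right (by positivity)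
      _ = (t ^ 2 + 2) ^ 2 * (T ^ 2 + 4) ^ 3 := by ring
      _ = ((t ^ 2 + 2) * S ^ 3) ^ 2 := by rw [← hS]; ring
  have hdiff : T + S ^ 3 / (T * (T ^ 2 + 6)) * ((t ^ 2 + 2) / s - (T ^ 2 + 2) / S) - t =
      ((t ^ 2 + 2) * S ^ 3 - s * (8 + T * (T ^ 2 + 6) * t)) / (T * (T ^ 2 + 6) * s) := by
    field_simp
    linear_combination (-(T ^ 2 + 2) * s) * hS
  rw [← sub_nonneg, hdiff]
  exact div_nonneg (sub_nonneg.2 key) (by positivity)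

theorem B_twoPointRho (ht : 0 ≤ t) : B (twoPointRho t) = t := by
  have hs : √(t ^ 2 + 4) ^ 2 = t ^ 2 + 4 := Real.sq_sqrt (by positivity)
  have hs0 : 0 < √(t ^ 2 + 4) := by positivity
  unfold B twoPointRho
  generalize √(t ^ 2 + 4) = s at *
  have hsqrt : √(((t ^ 2 + 2) / s) ^ 2 + 8) = (t ^ 2 + 6) / s := by
    rw [← Real.sqrt_sq (by positivity : 0 ≤ (t ^ 2 + 6) / s)]
    congr 1
    field_simp
    rw [hs]
    ring
  rw [hsqrt, ← Real.sqrt_sq ht]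
  congr 1
  rw [Real.sqrt_sq ht]
  field_simp
  linear_combination (-4 - 2 * t ^ 2) * hs

theorem monotoneOn_B : MonotoneOn B (Ici 0) := fun r hr s _ hrs => by
  have hr : 0 ≤ r := hr
  unfold B
  gcongr

theorem le_twoPointRho_of_B_lt (hr : 0 ≤ r) (h : B r < T) : r ≤ twoPointRho T := by
  have hT : 0 ≤ T := (Real.sqrt_nonneg _).trans h.le
  by_contra! hlt
  have := monotoneOn_B (show 0 ≤ twoPointRho T by unfold twoPointRho; positivity) hr hlt.le
  rw [B_twoPointRho hT] at this
  exact this.not_gt h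

end TwoPointRho

section Integrability

variable {ν : Measure ℝ}

theorem memLp_id_three_iff : MemLp id 3 ν ↔ Integrable (fun x => |x| ^ 3) ν := by
  rw [← integrable_norm_rpow_iff aestronglyMeasurable_id (by norm_num) (by norm_num)]
  norm_num

theorem integrable_of_memLp_three {E : Type*} [NormedAddCommGroup E] [NormedSpace ℝ E] {f : ℝ → E}
    {L : ℝ≥0} (hf : ContDiff ℝ 2 f) (hL : LipschitzWith L (iteratedDeriv 2 f))
    [IsFiniteMeasure ν] (hν : MemLp id 3 ν) : Integrable f ν := by
  let p : ℝ → E := fun x => f 0 + x • deriv f 0 + (x ^ 2 / 2) • iteratedDeriv 2 f 0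
  have hp : Integrable p ν :=
    ((integrable_const _).add ((hν.integrable (by norm_num)).smul_const _)).add
      (((hν.mono_exponent (by norm_num)).integrable_sq.div_const 2).smul_const _)
  have hp_cont : Continuous p := by fun_prop
  have hsub : Integrable (fun x => f x - p x) ν :=
    (((memLp_id_three_iff.1 hν).const_mul (L / 6 : ℝ)).mono'
      (hf.continuous.sub hp_cont).aestronglyMeasurable
      (Eventually.of_forall (norm_sub_taylor_two_le hf hL)))
  exact (hsub.add hp).congr (Eventually.of_forall fun x => sub_add_cancel (f x) (p x))

end Integrability

section ScalarFunctions

variable {f : ℝ → ℝ} {L : ℝ≥0}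

theorem lipschitzWith_iteratedDeriv_neg {n : ℕ} (hL : LipschitzWith L (iteratedDeriv n f)) :
    LipschitzWith L (iteratedDeriv n fun x => -f x) := by
  rw [show (iteratedDeriv n fun x => -f x) = -iteratedDeriv n f from
    funext fun x => iteratedDeriv_fun_neg n f x]
  exact hL.neg

theorem convexOn_add_deriv (hf : ContDiff ℝ 2 f) (hL : LipschitzWith L (iteratedDeriv 2 f)) :
    ConvexOn ℝ univ fun x => L / 2 * x ^ 2 + deriv f x := by
  have hderiv : ∀ x, HasDerivAt (fun x => L / 2 * x ^ 2 + deriv f x)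
      (L * x + iteratedDeriv 2 f x) x := fun x =>
     (((hasDerivAt_pow 2 x).const_mul (L / 2 : ℝ)).add
      (hasDerivAt_deriv_of_contDiff_two hf x)).congr_deriv (by simp; ring)
  refine Monotone.convexOn_univ_of_deriv (fun x => (hderiv x).differentiableAt) fun x y hxy => ?_
  rw [(hderiv x).deriv, (hderiv y).deriv]
  have := (le_abs_self _).trans (hL.norm_sub_le x y)
  rw [Real.norm_eq_abs, abs_of_nonpos (sub_nonpos.2 hxy)] at this
  linarith

theorem monotoneOn_twoPointMean_add (hf : ContDiff ℝ 2 f)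
    (hL : LipschitzWith L (iteratedDeriv 2 f)) :
    MonotoneOn (fun b => twoPointMean f b + L / 6 * (b - b⁻¹)) (Ioi 0) := by
  have hderiv : ∀ x, HasDerivAt (fun x => f x + L / 6 * x ^ 3) (L / 2 * x ^ 2 + deriv f x) x :=
    fun x => ((hf.differentiable (by simp) x).hasDerivAt.add
      ((hasDerivAt_pow 3 x).const_mul (L / 6 : ℝ))).congr_deriv (by simp; ring)
  exact (monotoneOn_twoPointMean hderiv (convexOn_add_deriv hf hL)).congr fun b hb =>
    twoPointMean_add_mul_pow_three f (L / 6) hb.out.ne'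

theorem twoPointMean_sub_twoPointMean_one_le (hf : ContDiff ℝ 2 f)
    (hL : LipschitzWith L (iteratedDeriv 2 f)) {b : ℝ} (hb : 0 < b) :
    twoPointMean f b - twoPointMean f 1 ≤ L / 6 * |b - b⁻¹| := by
  rcases le_total b 1 with h | h
  · have := monotoneOn_twoPointMean_add hf hL hb (mem_Ioi.2 one_pos) h
    simp only [inv_one, sub_self, mul_zero, add_zero] at this
    have := mul_le_mul_of_nonneg_left (neg_le_abs (b - b⁻¹)) (by positivity : (0 : ℝ) ≤ L / 6)
    linarith
  · have := monotoneOn_twoPointMean_add hf.neg (lipschitzWith_iteratedDeriv_neg hL)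
      (mem_Ioi.2 one_pos) hb h
    simp only [twoPointMean_neg, inv_one, sub_self, mul_zero, add_zero] at this
    have := mul_le_mul_of_nonneg_left (le_abs_self (b - b⁻¹)) (by positivity : (0 : ℝ) ≤ L / 6)
    linarith

theorem convexOn_deriv_sub_of_le (hf : ContDiff ℝ 2 f) (hL : LipschitzWith L (iteratedDeriv 2 f))
    {c : ℝ} (hc : L / 6 ≤ c) : ConvexOn ℝ (Iic 0) fun x => deriv f x - c * (3 * |x| * x) := by
  have hsq : ConvexOn ℝ (Iic 0) fun x : ℝ => (3 * c - L / 2) * x ^ 2 :=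
    ((even_two.convexOn_pow (𝕜 := ℝ)).subset (subset_univ _) (convex_Iic 0)).smul (by linarith)
  refine (((convexOn_add_deriv hf hL).subset (subset_univ _) (convex_Iic 0)).add hsq).congr
    fun x hx => ?_
  simp only [Pi.add_apply, abs_of_nonpos hx.out]
  ring

theorem concaveOn_deriv_sub_of_le (hf : ContDiff ℝ 2 f)
    (hL : LipschitzWith L (iteratedDeriv 2 f)) {c : ℝ} (hc : L / 6 ≤ c) :
    ConcaveOn ℝ (Ici 0) fun x => deriv f x - c * (3 * |x| * x) := by
  have hsq : ConvexOn ℝ (Ici 0) fun x : ℝ => (3 * c - L / 2) * x ^ 2 :=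
    ((even_two.convexOn_pow (𝕜 := ℝ)).subset (subset_univ _) (convex_Ici 0)).smul (by linarith)
  refine (((convexOn_add_deriv hf.neg (lipschitzWith_iteratedDeriv_neg hL)).subset
    (subset_univ _) (convex_Ici 0)).add hsq).neg.congr fun x hx => ?_
  simp only [Pi.neg_apply, Pi.add_apply, deriv.fun_neg, abs_of_nonneg hx.out]
  ring

theorem hasDerivAt_abs_pow_three (x : ℝ) : HasDerivAt (fun x : ℝ => |x| ^ 3) (3 * |x| * x) x := by
  have := hasDerivAt_abs_rpow x (p := 3) (by norm_num)
  norm_num at this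
  exact this

theorem twoPointMean_sub_le (hf : ContDiff ℝ 2 f) (hL : LipschitzWith L (iteratedDeriv 2 f))
    {b T : ℝ} (hb : 0 < b) (hT : 0 < T) :
    twoPointMean (f - fun x => L / 6 * tangentSlope T * |x| ^ 3) b ≤
      twoPointMean f 1 + L / 6 * (T - tangentSlope T * twoPointRho T) := by
  have hsub := twoPointMean_sub_twoPointMean_one_le hf hL hb
  have htangent := mul_le_mul_of_nonneg_left (le_tangent (abs_nonneg (b - b⁻¹)) hT)
    (by positivity : (0 : ℝ) ≤ L / 6)
  rw [← twoPointMean_abs_pow_three hb] at htangent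
  calc twoPointMean (f - fun x => L / 6 * tangentSlope T * |x| ^ 3) b
      = twoPointMean f b - L / 6 * tangentSlope T * twoPointMean (fun x => |x| ^ 3) b := by
        simp only [twoPointMean, Pi.sub_apply]
        ring
    _ ≤ twoPointMean f 1 + L / 6 * (T - tangentSlope T * twoPointRho T) := by linarith

theorem integral_le_twoPointMean_one_add (hf : ContDiff ℝ 2 f) (hL0 : 0 < L)
    (hL : LipschitzWith L (iteratedDeriv 2 f)) {ν : Measure ℝ} [IsProbabilityMeasure ν]
    (hν : MemLp id 3 ν) (hmean : ∫ x, x ∂ν = 0) (hvar : ∫ x, x ^ 2 ∂ν = 1) {T : ℝ} (hT : 0 < T)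
    (hrho : ∫ x, |x| ^ 3 ∂ν ≤ twoPointRho T) :
    ∫ x, f x ∂ν ≤ twoPointMean f 1 + L / 6 * T := by
  set c := L / 6 * tangentSlope T with hc
  have hLc : L / 6 < c := lt_mul_of_one_lt_right (by positivity) (one_lt_tangentSlope hT)
  obtain ⟨b, hb, hmax⟩ := exists_integral_le_twoPointMean
    (fun x => (hf.differentiable (by simp) x).hasDerivAt.sub
      ((hasDerivAt_abs_pow_three x).const_mul c))
    (convexOn_deriv_sub_of_le hf hL hLc.le) (concaveOn_deriv_sub_of_le hf hL hLc.le)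
    (sub_pos.2 hLc) (α := f 0) (β := deriv f 0) (γ := iteratedDeriv 2 f 0 / 2) fun x => by
      have := (le_abs_self _).trans (norm_sub_taylor_two_le hf hL x)
      simp only [smul_eq_mul] at this
      simp only [Pi.sub_apply]
      linarith
  have hfν := integrable_of_memLp_three hf hL hν
  have h₃ := (memLp_id_three_iff.1 hν).const_mul c
  have hint := hmax ν inferInstance (hfν.sub h₃) (hν.mono_exponent (by norm_num)) hmean hvar
  rw [integral_sub' hfν h₃, integral_const_mul] at hint
  calc ∫ x, f x ∂ν
      ≤ twoPointMean (f - fun x => c * |x| ^ 3) b + c * ∫ x, |x| ^ 3 ∂ν := by linarith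
    _ ≤ twoPointMean f 1 + L / 6 * (T - tangentSlope T * twoPointRho T) + c * twoPointRho T := by
        have hc0 : 0 ≤ c := (by positivity : (0 : ℝ) ≤ L / 6).trans hLc.le
        have := twoPointMean_sub_le hf hL hb hT
        gcongr
    _ = twoPointMean f 1 + L / 6 * T := by
        rw [hc]
        ring

end ScalarFunctions

theorem sd_sq (P : Measure ℝ) : sd P ^ 2 = Var[id; P] :=
  Real.sq_sqrt (variance_nonneg _ _)

theorem sd_sq_eq_integral (P : Measure ℝ) : sd P ^ 2 = ∫ x, (x - mean P) ^ 2 ∂P := by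
  rw [sd_sq, variance_eq_integral aemeasurable_id]
  rfl

section TwoPointLaw

variable {p a b : ℝ}

/-- The law with mass `p` at `a` and mass `1 - p` at `b`. -/
noncomputable def twoPointLaw (p a b : ℝ) : Measure ℝ :=
  ENNReal.ofReal p • Measure.dirac a + ENNReal.ofReal (1 - p) • Measure.dirac b

theorem half_smul_dirac_add_dirac (a b : ℝ) :
    (2⁻¹ : ENNReal) • (Measure.dirac a + Measure.dirac b) = twoPointLaw 2⁻¹ a b := by
  rw [twoPointLaw, show (1 - 2⁻¹ : ℝ) = 2⁻¹ by norm_num, ENNReal.ofReal_inv_of_pos two_pos,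
    ENNReal.ofReal_ofNat, smul_add]

theorem symTwoPoint_eq (s : ℝ) : symTwoPoint s = twoPointLaw 2⁻¹ (-s) s :=
  half_smul_dirac_add_dirac _ _

theorem isProbabilityMeasure_twoPointLaw (hp : p ∈ Icc 0 1) (a b : ℝ) :
    IsProbabilityMeasure (twoPointLaw p a b) :=
  ⟨by simp [twoPointLaw, ← ENNReal.ofReal_add hp.1 (sub_nonneg.2 hp.2)]⟩

theorem map_twoPointLaw {g : ℝ → ℝ} (hg : Measurable g) (p a b : ℝ) :
    (twoPointLaw p a b).map g = twoPointLaw p (g a) (g b) := by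
  simp only [twoPointLaw, Measure.map_add _ _ hg, Measure.map_smul, Measure.map_dirac' hg]

theorem integrable_twoPointLaw {E : Type*} [NormedAddCommGroup E] (f : ℝ → E) (p a b : ℝ) :
    Integrable f (twoPointLaw p a b) :=
  ((integrable_dirac (by simp)).smul_measure ENNReal.ofReal_ne_top).add_measure
    ((integrable_dirac (by simp)).smul_measure ENNReal.ofReal_ne_top)

theorem integral_twoPointLaw {E : Type*} [NormedAddCommGroup E] [NormedSpace ℝ E]
    [CompleteSpace E] (hp : p ∈ Icc 0 1) (f : ℝ → E) (a b : ℝ) :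
    ∫ x, f x ∂(twoPointLaw p a b) = p • f a + (1 - p) • f b := by
  rw [twoPointLaw, integral_add_measure
    ((integrable_dirac (by simp)).smul_measure ENNReal.ofReal_ne_top)
    ((integrable_dirac (by simp)).smul_measure ENNReal.ofReal_ne_top)]
  simp [integral_smul_measure, hp.1, hp.2]

theorem mean_twoPointLaw (hp : p ∈ Icc 0 1) (a b : ℝ) :
    mean (twoPointLaw p a b) = p * a + (1 - p) * b :=
  integral_twoPointLaw hp (fun x => x) a b

theorem sd_twoPointLaw (hp : p ∈ Icc 0 1) (a b : ℝ) :
    sd (twoPointLaw p a b) = √(p * (1 - p)) * |a - b| := by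
  have hsq : sd (twoPointLaw p a b) ^ 2 = p * (1 - p) * (a - b) ^ 2 := by
    rw [sd_sq_eq_integral, integral_twoPointLaw hp, mean_twoPointLaw hp]
    simp only [smul_eq_mul]
    ring
  have hsd : 0 ≤ sd (twoPointLaw p a b) := Real.sqrt_nonneg _
  rw [← Real.sqrt_sq hsd, hsq, Real.sqrt_mul (mul_nonneg hp.1 (sub_nonneg.2 hp.2)),
    Real.sqrt_sq_eq_abs]

theorem centredThird_twoPointLaw (hp : p ∈ Icc 0 1) (a b : ℝ) :
    centredThird (twoPointLaw p a b) = p * (1 - p) * (1 - 2 * p) * (a - b) ^ 3 := by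
  rw [centredThird, integral_twoPointLaw hp, mean_twoPointLaw hp]
  simp only [smul_eq_mul]
  ring

theorem rho_twoPointLaw (hp : p ∈ Ioo 0 1) (hab : a ≠ b) :
    rho (twoPointLaw p a b) = twoPointRho (|1 - 2 * p| / √(p * (1 - p))) := by
  have hp' : p ∈ Icc 0 1 := Ioo_subset_Icc_self hp
  have h1p : 0 < 1 - p := sub_pos.2 hp.2
  have hw : √(p * (1 - p)) ^ 2 = p * (1 - p) := Real.sq_sqrt (mul_pos hp.1 h1p).le
  have hw0 : 0 < √(p * (1 - p)) := Real.sqrt_pos.2 (mul_pos hp.1 h1p)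
  have hd : |a - b| ≠ 0 := abs_ne_zero.2 (sub_ne_zero.2 hab)
  rw [rho, integral_twoPointLaw hp', mean_twoPointLaw hp', sd_twoPointLaw hp', twoPointRho]
  generalize √(p * (1 - p)) = w at *
  have hsq : (|1 - 2 * p| / w) ^ 2 + 4 = w⁻¹ ^ 2 := by
    rw [div_pow, sq_abs]
    field_simp
    linear_combination 4 * hw
  have ha : |(a - (p * a + (1 - p) * b)) / (w * |a - b|)| = (1 - p) / w := by
    rw [show a - (p * a + (1 - p) * b) = (1 - p) * (a - b) by ring, abs_div, abs_mul, abs_mul,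
      abs_abs, abs_of_pos h1p, abs_of_pos hw0, mul_div_mul_right _ _ hd]
  have hb : |(b - (p * a + (1 - p) * b)) / (w * |a - b|)| = p / w := by
    rw [show b - (p * a + (1 - p) * b) = -(p * (a - b)) by ring, abs_div, abs_neg, abs_mul,
      abs_mul, abs_abs, abs_of_pos hp.1, abs_of_pos hw0, mul_div_mul_right _ _ hd]
  rw [ha, hb, hsq, Real.sqrt_sq (inv_pos.2 hw0).le]
  simp only [smul_eq_mul, div_pow, sq_abs]
  field_simp
  linear_combination (2 * p * (1 - p) - 2 * w ^ 2 - 1) * hw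

theorem IsTwoPoint.sd_pow_three_mul_B_rho {P : Measure ℝ} (hP : IsTwoPoint P) :
    sd P ^ 3 * B (rho P) = |centredThird P| := by
  obtain ⟨a, b, p, hab, hp0, hp1, rfl⟩ := hP
  change sd (twoPointLaw p a b) ^ 3 * B (rho (twoPointLaw p a b)) =
    |centredThird (twoPointLaw p a b)|
  have hp : p ∈ Icc 0 1 := ⟨hp0.le, hp1.le⟩
  have hvar : 0 < p * (1 - p) := mul_pos hp0 (sub_pos.2 hp1)
  have hw : √(p * (1 - p)) ^ 2 = p * (1 - p) := Real.sq_sqrt hvar.le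
  rw [rho_twoPointLaw ⟨hp0, hp1⟩ hab, B_twoPointRho (by positivity), sd_twoPointLaw hp,
    centredThird_twoPointLaw hp, abs_mul, abs_mul, abs_of_pos hvar, abs_pow]
  field_simp
  rw [hw]

theorem standardize_twoPointLaw_half (hab : a < b) :
    standardize (twoPointLaw 2⁻¹ a b) = symTwoPoint 1 := by
  have hp : (2⁻¹ : ℝ) ∈ Icc 0 1 := by norm_num
  have hsd : sd (twoPointLaw 2⁻¹ a b) = (b - a) / 2 := by
    rw [sd_twoPointLaw hp, abs_sub_comm, abs_of_pos (sub_pos.2 hab),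
      show (2⁻¹ * (1 - 2⁻¹) : ℝ) = 2⁻¹ ^ 2 by norm_num, Real.sqrt_sq (by norm_num)]
    ring
  have hne : b - a ≠ 0 := (sub_pos.2 hab).ne'
  rw [standardize, map_twoPointLaw (by fun_prop), mean_twoPointLaw hp, hsd, symTwoPoint_eq]
  congr 1 <;> field_simp <;> ring

theorem isProbabilityMeasure_symTwoPoint (s : ℝ) : IsProbabilityMeasure (symTwoPoint s) :=
  symTwoPoint_eq s ▸ isProbabilityMeasure_twoPointLaw (by norm_num) _ _

theorem sd_symTwoPoint {s : ℝ} (hs : 0 ≤ s) : sd (symTwoPoint s) = s := by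
  rw [symTwoPoint_eq, sd_twoPointLaw (by norm_num), abs_sub_comm, sub_neg_eq_add,
    abs_of_nonneg (add_nonneg hs hs), show (2⁻¹ * (1 - 2⁻¹) : ℝ) = 2⁻¹ ^ 2 by norm_num,
    Real.sqrt_sq (by norm_num)]
  ring

theorem centredThird_symTwoPoint (s : ℝ) : centredThird (symTwoPoint s) = 0 := by
  rw [symTwoPoint_eq, centredThird_twoPointLaw (by norm_num)]
  ring

theorem isP3_symTwoPoint {s : ℝ} (hs : 0 < s) : IsP3 (symTwoPoint s) where
  isProb := isProbabilityMeasure_symTwoPoint s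
  moment := symTwoPoint_eq s ▸ integrable_twoPointLaw _ _ _ _
  sd_pos := by rwa [sd_symTwoPoint hs.le]

theorem standardize_symTwoPoint {s : ℝ} (hs : 0 < s) :
    standardize (symTwoPoint s) = symTwoPoint 1 := by
  rw [symTwoPoint_eq s, standardize_twoPointLaw_half (by linarith)]

end TwoPointLaw

section OneSummand

variable {E : Type*} [NormedAddCommGroup E] [NormedSpace ℝ E] {f : ℝ → E} {L : ℝ≥0}

theorem iteratedDeriv_continuousLinearMap_comp {n : ℕ} {G : Type*} [NormedAddCommGroup G]
    [NormedSpace ℝ G] (φ : E →L[ℝ] G) (hf : ContDiff ℝ n f) :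
    iteratedDeriv n (φ ∘ f) = φ ∘ iteratedDeriv n f := by
  funext x
  simp [iteratedDeriv_eq_iteratedFDeriv, φ.iteratedFDeriv_comp_left hf.contDiffAt le_rfl]

variable [CompleteSpace E]

theorem norm_integral_sub_integral_symTwoPoint_one_le (hf : ContDiff ℝ 2 f)
    (hL : LipschitzWith L (iteratedDeriv 2 f)) {ν : Measure ℝ} [IsProbabilityMeasure ν]
    (hν : MemLp id 3 ν) (hmean : ∫ x, x ∂ν = 0) (hvar : ∫ x, x ^ 2 ∂ν = 1) :
    ‖∫ x, f x ∂ν - ∫ x, f x ∂(symTwoPoint 1)‖ ≤ L / 6 * B (∫ x, |x| ^ 3 ∂ν) := by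
  set r := ∫ x, |x| ^ 3 ∂ν
  have hr0 : 0 ≤ r := integral_nonneg fun x => by positivity
  obtain ⟨φ, hφ, hφx⟩ := exists_dual_vector'' ℝ (∫ x, f x ∂ν - ∫ x, f x ∂(symTwoPoint 1))
  have hφf : ContDiff ℝ 2 (φ ∘ f) := φ.contDiff.comp hf
  have hφL : LipschitzWith L (iteratedDeriv 2 (φ ∘ f)) := by
    rw [iteratedDeriv_continuousLinearMap_comp φ hf]
    simpa using (φ.lipschitz.weaken (show ‖φ‖₊ ≤ 1 from hφ)).comp hL
  have hφ_integral : φ (∫ x, f x ∂ν - ∫ x, f x ∂(symTwoPoint 1)) =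
      ∫ x, (φ ∘ f) x ∂ν - twoPointMean (φ ∘ f) 1 := by
    rw [map_sub, ← φ.integral_comp_comm (integrable_of_memLp_three hf hL hν), symTwoPoint_eq,
      integral_twoPointLaw (by norm_num), twoPointMean_one, map_add, map_smul, map_smul]
    simp only [Function.comp_apply, smul_eq_mul]
    ring
  -- the strict inequalities needed above are obtained by enlarging both factors of the bound
  have hle : ∀ ε : ℝ≥0, 0 < ε →
      ‖∫ x, f x ∂ν - ∫ x, f x ∂(symTwoPoint 1)‖ ≤ (L + ε) / 6 * (B r + ε) := fun ε hε => by
    have hT : B r < B r + ε := lt_add_of_pos_right _ hε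
    have := integral_le_twoPointMean_one_add hφf (add_pos_of_nonneg_of_pos L.2 hε)
      (hφL.weaken le_self_add) hν hmean hvar ((Real.sqrt_nonneg _).trans_lt hT)
      (le_twoPointRho_of_B_lt hr0 hT)
    have h := hφx.symm.trans hφ_integral
    push_cast at this
    simp only [RCLike.ofReal_real_eq_id, id] at h
    linarith
  have hlim : Tendsto (fun ε : ℝ≥0 => ((L : ℝ) + ε) / 6 * (B r + ε)) (𝓝[>] 0)
      (𝓝 (L / 6 * B r)) := by
    have hcont : Continuous fun ε : ℝ≥0 => ((L : ℝ) + ε) / 6 * (B r + ε) := by fun_prop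
    simpa using (hcont.tendsto 0).mono_left nhdsWithin_le_nhds
  exact ge_of_tendsto hlim (eventually_mem_nhdsWithin.mono hle)

end OneSummand

section Convolution

variable {n : ℕ} {P Q : Fin n → Measure ℝ}

instance isProbabilityMeasure_convolution [∀ i, IsProbabilityMeasure (P i)] :
    IsProbabilityMeasure (convolution P) :=
  Measure.isProbabilityMeasure_map (by fun_prop)

theorem convolution_map [∀ i, IsProbabilityMeasure (P i)] {g : Fin n → ℝ → ℝ}
    (hg : ∀ i, Measurable (g i)) :
    convolution (fun i => (P i).map (g i)) = (Measure.pi P).map fun x => ∑ i, g i (x i) := by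
  have (i : Fin n) : IsProbabilityMeasure ((P i).map (g i)) :=
    Measure.isProbabilityMeasure_map (hg i).aemeasurable
  rw [convolution, ← Measure.pi_map_pi fun i => (hg i).aemeasurable,
    Measure.map_map (by fun_prop) (by fun_prop)]
  rfl

theorem convolution_eq_conv {P : Fin (n + 1) → Measure ℝ} [∀ i, IsProbabilityMeasure (P i)]
    (j : Fin (n + 1)) : convolution P = P j ∗ convolution fun i => P (j.succAbove i) := by
  have hmap : P j ∗ convolution (fun i => P (j.succAbove i)) =
      ((P j).prod (Measure.pi fun i => P (j.succAbove i))).map fun z => z.1 + ∑ i, z.2 i := by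
    conv_lhs => rw [convolution, Measure.conv, ← Measure.map_id (μ := P j)]
    rw [Measure.map_prod_map _ _ measurable_id (by fun_prop),
      Measure.map_map (by fun_prop) (by fun_prop)]
    rfl
  rw [hmap, ← (measurePreserving_piFinSuccAbove P j).map_eq,
    Measure.map_map (by fun_prop) (MeasurableEquiv.measurable _), convolution]
  congr 1
  funext x
  exact Fin.sum_univ_succAbove x j

variable {E : Type*} [NormedAddCommGroup E] [NormedSpace ℝ E] {f : ℝ → E}

theorem norm_integral_conv_sub_le {μ ν κ : Measure ℝ} [SFinite μ] [SFinite ν]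
    [IsProbabilityMeasure κ] (hμ : Integrable f (μ ∗ κ)) (hν : Integrable f (ν ∗ κ)) {c : ℝ}
    (hc : ∀ x, ‖∫ y, f (x + y) ∂μ - ∫ y, f (x + y) ∂ν‖ ≤ c) :
    ‖∫ x, f x ∂(μ ∗ κ) - ∫ x, f x ∂(ν ∗ κ)‖ ≤ c := by
  have hinner {μ : Measure ℝ} [SFinite μ] (h : Integrable f (κ ∗ μ)) :
      Integrable (fun x => ∫ y, f (x + y) ∂μ) κ :=
    ((integrable_map_measure h.1 (by fun_prop)).1 h).integral_prod_left
  rw [Measure.conv_comm] at hμ hν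
  rw [Measure.conv_comm μ, Measure.conv_comm ν, integral_conv hμ, integral_conv hν,
    ← integral_sub (hinner hμ) (hinner hν)]
  simpa using norm_integral_le_of_norm_le_const (μ := κ) (Eventually.of_forall hc)

theorem norm_integral_convolution_sub_update_le [∀ i, IsProbabilityMeasure (P i)] {i : Fin n}
    {ν : Measure ℝ} [IsProbabilityMeasure ν] (hP : Integrable f (convolution P))
    (hν : Integrable f (convolution (Function.update P i ν))) {c : ℝ}
    (hc : ∀ x, ‖∫ y, f (x + y) ∂(P i) - ∫ y, f (x + y) ∂ν‖ ≤ c) :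
    ‖∫ x, f x ∂(convolution P) - ∫ x, f x ∂(convolution (Function.update P i ν))‖ ≤ c := by
  obtain _ | n := n
  · exact i.elim0
  have (j : Fin (n + 1)) : IsProbabilityMeasure (Function.update P i ν j) := by
    obtain rfl | hj := eq_or_ne j i
    · rwa [Function.update_self]
    · rw [Function.update_of_ne hj]
      infer_instance
  have hupdate : convolution (Function.update P i ν) =
      ν ∗ convolution fun j => P (i.succAbove j) := by
    simp [convolution_eq_conv i]
  rw [convolution_eq_conv i] at hP ⊢
  rw [hupdate] at hν ⊢
  exact norm_integral_conv_sub_le hP hν hc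

theorem norm_integral_convolution_sub_le [∀ i, IsProbabilityMeasure (P i)]
    [∀ i, IsProbabilityMeasure (Q i)]
    (hf : ∀ s : Finset (Fin n), Integrable f (convolution (s.piecewise Q P))) {c : Fin n → ℝ}
    (hc : ∀ i x, ‖∫ y, f (x + y) ∂(P i) - ∫ y, f (x + y) ∂(Q i)‖ ≤ c i) :
    ‖∫ x, f x ∂(convolution P) - ∫ x, f x ∂(convolution Q)‖ ≤ ∑ i, c i := by
  have hreplace (s : Finset (Fin n)) :
      ‖∫ x, f x ∂(convolution P) - ∫ x, f x ∂(convolution (s.piecewise Q P))‖ ≤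
        ∑ i ∈ s, c i := by
    induction s using Finset.induction_on with
    | empty => simp
    | insert i s hi ih =>
      have (j : Fin n) : IsProbabilityMeasure (s.piecewise Q P j) :=
        s.piecewise_cases Q P _ inferInstance inferInstance
      have hinsert := hf (insert i s)
      rw [Finset.piecewise_insert] at hinsert
      rw [Finset.piecewise_insert, Finset.sum_insert hi, add_comm]
      exact (norm_sub_le_norm_sub_add_norm_sub _ _ _).trans <| add_le_add ih <|
        norm_integral_convolution_sub_update_le (hf s) hinsert fun x => by
          rw [Finset.piecewise_eq_of_notMem _ _ _ hi]
          exact hc i x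
  simpa using hreplace Finset.univ

end Convolution

section Moments

variable {n : ℕ} {P : Fin n → Measure ℝ} [∀ i, IsProbabilityMeasure (P i)]

theorem memLp_id_convolution {p : ENNReal} (hP : ∀ i, MemLp id p (P i)) :
    MemLp id p (convolution P) := by
  rw [convolution, memLp_map_measure_iff (by fun_prop) (by fun_prop)]
  exact memLp_finsetSum Finset.univ (f := fun i (x : Fin n → ℝ) => x i) fun i _ =>
    (hP i).comp_measurePreserving (measurePreserving_eval P i)

theorem mean_convolution (hP : ∀ i, Integrable id (P i)) :
    mean (convolution P) = ∑ i, mean (P i) := by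
  rw [mean, convolution, integral_map (by fun_prop) (by fun_prop),
    integral_finsetSum (f := fun i (x : Fin n → ℝ) => x i) Finset.univ fun i _ =>
      integrable_eval (hP i)]
  exact Finset.sum_congr rfl fun i _ => integral_eval

theorem sd_convolution (hP : ∀ i, MemLp id 2 (P i)) :
    sd (convolution P) = √(∑ i, sd (P i) ^ 2) := by
  simp only [sd_sq]
  rw [sd, convolution, variance_map (by fun_prop) (by fun_prop), ← variance_sum_pi hP]
  congr 2
  funext x
  simp

theorem integrable_sub_const_pow {ν : Measure ℝ} [IsFiniteMeasure ν] {k : ℕ} (hν : MemLp id k ν)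
    (c : ℝ) : Integrable (fun x => (x - c) ^ k) ν := by
  have hsub : MemLp (fun x => x - c) k ν := hν.sub (memLp_const c)
  refine (integrable_norm_iff (by fun_prop)).1 ?_
  simpa only [norm_pow] using hsub.integrable_norm_pow'

theorem integral_sub_mean {ν : Measure ℝ} [IsProbabilityMeasure ν] (hν : Integrable id ν) :
    ∫ x, (x - mean ν) ∂ν = 0 :=
  (integral_sub hν (integrable_const _)).trans (by simp [mean])

theorem integral_add_sub_mean_pow_three {ν : Measure ℝ} [IsProbabilityMeasure ν]
    (hν : MemLp id 3 ν) (a : ℝ) :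
    ∫ y, (a + (y - mean ν)) ^ 3 ∂ν = a ^ 3 + 3 * a * sd ν ^ 2 + centredThird ν := by
  have hint : Integrable id ν := hν.integrable (by norm_num)
  have h₁ : Integrable (fun y => y - mean ν) ν := hint.sub (integrable_const _)
  have h₂ : Integrable (fun y => (y - mean ν) ^ 2) ν :=
    integrable_sub_const_pow (hν.mono_exponent (by norm_num)) _
  have h₃ : Integrable (fun y => (y - mean ν) ^ 3) ν := integrable_sub_const_pow hν _
  calc ∫ y, (a + (y - mean ν)) ^ 3 ∂ν
      = ∫ y, (a ^ 3 + 3 * a ^ 2 * (y - mean ν) + 3 * a * (y - mean ν) ^ 2 +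
          (y - mean ν) ^ 3) ∂ν := by
        congr with y
        ring
    _ = a ^ 3 + 3 * a ^ 2 * ∫ y, (y - mean ν) ∂ν + 3 * a * ∫ y, (y - mean ν) ^ 2 ∂ν +
          ∫ y, (y - mean ν) ^ 3 ∂ν := by
        rw [integral_add (by fun_prop) h₃, integral_add (by fun_prop) (by fun_prop),
          integral_add (by fun_prop) (by fun_prop), integral_const_mul, integral_const_mul]
        simp
    _ = a ^ 3 + 3 * a * sd ν ^ 2 + centredThird ν := by
        rw [integral_sub_mean hint, sd_sq_eq_integral, centredThird]
        ring

section Conv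

variable {μ ν : Measure ℝ} [IsProbabilityMeasure μ] [IsProbabilityMeasure ν]

theorem memLp_id_conv {p : ENNReal} (hμ : MemLp id p μ) (hν : MemLp id p ν) :
    MemLp id p (μ ∗ ν) := by
  rw [Measure.conv, memLp_map_measure_iff (by fun_prop) (by fun_prop)]
  exact (hμ.comp_fst ν).add (hν.comp_snd μ)

theorem mean_conv (hμ : Integrable id μ) (hν : Integrable id ν) :
    mean (μ ∗ ν) = mean μ + mean ν := by
  rw [mean, Measure.conv, integral_map (by fun_prop) (by fun_prop)]
  calc ∫ z, id z.1 + id z.2 ∂(μ.prod ν) = ∫ z, id z.1 ∂(μ.prod ν) + ∫ z, id z.2 ∂(μ.prod ν) :=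
        integral_add (hμ.comp_fst ν) (hν.comp_snd μ)
    _ = mean μ + mean ν := by
        rw [integral_fun_fst, integral_fun_snd]
        simp [mean]

theorem centredThird_conv (hμ : MemLp id 3 μ) (hν : MemLp id 3 ν) :
    centredThird (μ ∗ ν) = centredThird μ + centredThird ν := by
  have hμ₁ : Integrable id μ := hμ.integrable (by norm_num)
  have hν₁ : Integrable id ν := hν.integrable (by norm_num)
  have hcube : Integrable (fun x => (x - mean (μ ∗ ν)) ^ 3) (μ ∗ ν) :=
    integrable_sub_const_pow (memLp_id_conv hμ hν) _
  have hinner (x : ℝ) : ∫ y, (x + y - mean (μ ∗ ν)) ^ 3 ∂ν =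
      (x - mean μ) ^ 3 + 3 * (x - mean μ) * sd ν ^ 2 + centredThird ν := by
    rw [mean_conv hμ₁ hν₁, ← integral_add_sub_mean_pow_three hν]
    congr with y
    ring
  have h₁ : Integrable (fun x => x - mean μ) μ := hμ₁.sub (integrable_const _)
  have h₃ : Integrable (fun x => (x - mean μ) ^ 3) μ := integrable_sub_const_pow hμ _
  rw [centredThird, integral_conv hcube]
  simp only [hinner]
  rw [integral_add (by fun_prop) (by fun_prop), integral_add (by fun_prop) (by fun_prop),
    integral_mul_const, integral_const_mul, integral_sub_mean hμ₁]
  simp [centredThird]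

end Conv

theorem centredThird_convolution (hP : ∀ i, MemLp id 3 (P i)) :
    centredThird (convolution P) = ∑ i, centredThird (P i) := by
  induction n with
  | zero => simp [centredThird, mean, convolution]
  | succ n ih =>
    rw [convolution_eq_conv 0, centredThird_conv (hP 0) (memLp_id_convolution fun i => hP _),
      ih fun i => hP _, Fin.sum_univ_succAbove _ 0]

end Moments

section Standardization

variable {P : Measure ℝ}

theorem IsP3.memLp (hP : IsP3 P) : MemLp id 3 P := memLp_id_three_iff.2 hP.moment

instance isProbabilityMeasure_standardize [IsProbabilityMeasure P] :
    IsProbabilityMeasure (standardize P) :=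
  Measure.isProbabilityMeasure_map (by fun_prop)

theorem integral_standardize {E : Type*} [NormedAddCommGroup E] [NormedSpace ℝ E] {f : ℝ → E}
    (hf : Continuous f) : ∫ x, f x ∂(standardize P) = ∫ x, f ((x - mean P) / sd P) ∂P :=
  integral_map (by fun_prop) hf.aestronglyMeasurable

theorem memLp_id_standardize [IsFiniteMeasure P] {p : ENNReal} (hP : MemLp id p P) :
    MemLp id p (standardize P) := by
  rw [standardize, memLp_map_measure_iff aestronglyMeasurable_id (by fun_prop)]
  simpa only [div_eq_mul_inv] using! (hP.sub (memLp_const (mean P))).mul_const (sd P)⁻¹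

theorem memLp_id_map_const_mul {μ : Measure ℝ} {p : ENNReal} (hμ : MemLp id p μ) (a : ℝ) :
    MemLp id p (μ.map (a * ·)) :=
  (memLp_map_measure_iff aestronglyMeasurable_id (by fun_prop)).2 (hμ.const_mul a)

theorem integral_id_standardize [IsProbabilityMeasure P] (hP : Integrable id P) :
    ∫ x, x ∂(standardize P) = 0 := by
  rw [integral_standardize continuous_id', integral_div, integral_sub_mean hP, zero_div]

theorem integral_sq_standardize (hP : sd P ≠ 0) : ∫ x, x ^ 2 ∂(standardize P) = 1 := by
  rw [integral_standardize (continuous_pow 2)]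
  simp only [div_pow]
  rw [integral_div, ← sd_sq_eq_integral, div_self (pow_ne_zero 2 hP)]

theorem integral_abs_pow_three_standardize : ∫ x, |x| ^ 3 ∂(standardize P) = rho P :=
  integral_standardize (by fun_prop)

theorem integral_pow_three_standardize :
    ∫ x, x ^ 3 ∂(standardize P) = centredThird P / sd P ^ 3 := by
  rw [integral_standardize (continuous_pow 3)]
  simp only [div_pow]
  rw [integral_div, centredThird]

theorem standardize_convolution {n : ℕ} {P : Fin n → Measure ℝ} [∀ i, IsProbabilityMeasure (P i)]
    (hP : ∀ i, MemLp id 2 (P i)) (hsd : ∀ i, sd (P i) ≠ 0) :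
    standardize (convolution P) =
      convolution fun i => (standardize (P i)).map (sd (P i) / √(∑ j, sd (P j) ^ 2) * ·) := by
  set σ := √(∑ j, sd (P j) ^ 2)
  have hscale (i : Fin n) : (standardize (P i)).map (sd (P i) / σ * ·) =
      (P i).map fun x => (x - mean (P i)) / σ := by
    rw [standardize, Measure.map_map (by fun_prop) (by fun_prop)]
    congr 1
    funext x
    exact div_mul_div_cancel₀' (hsd i) _ _
  simp only [hscale]
  rw [convolution_map fun i => by fun_prop, standardize, sd_convolution hP,
    mean_convolution fun i => (hP i).integrable (by norm_num), convolution,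
    Measure.map_map (by fun_prop) (by fun_prop)]
  congr 1
  funext x
  rw [Function.comp_apply, ← Finset.sum_sub_distrib, Finset.sum_div]

theorem standardize_convPow [IsProbabilityMeasure P] (hP : MemLp id 2 P) (hsd : 0 < sd P) (n : ℕ) :
    standardize (convPow P n) = convPow ((standardize P).map ((√n)⁻¹ * ·)) n := by
  rw [convPow, standardize_convolution (fun _ => hP) fun _ => hsd.ne', convPow]
  have hscale : sd P / √(∑ _j : Fin n, sd P ^ 2) = (√n)⁻¹ := by
    rw [Fin.sum_const, nsmul_eq_mul, Real.sqrt_mul n.cast_nonneg, Real.sqrt_sq hsd.le,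
      div_mul_cancel_right₀ hsd.ne']
  rw [hscale]

end Standardization

section LipschitzConstant

variable {E : Type*} [NormedAddCommGroup E] {g : ℝ → E}

theorem lipNorm_nonneg : 0 ≤ lipNorm g :=
  Real.sSup_nonneg <| by
    rintro _ ⟨x, y, -, rfl⟩
    positivity

theorem lipschitzWith_toNNReal_lipNorm (hg : BddAbove (lipQuotients g)) :
    LipschitzWith (lipNorm g).toNNReal g :=
  LipschitzWith.of_dist_le_mul fun x y => by
    rw [Real.coe_toNNReal _ lipNorm_nonneg, dist_eq_norm, Real.dist_eq]
    obtain rfl | hxy := eq_or_ne x y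
    · simp
    · rw [← div_le_iff₀ (abs_pos.2 (sub_ne_zero.2 hxy))]
      exact le_csSup hg ⟨x, y, hxy, rfl⟩

variable [NormedSpace ℝ E]

theorem iteratedDeriv_two_pow_three_smul (c : E) :
    iteratedDeriv 2 (fun x : ℝ => x ^ 3 • c) = fun x => (6 * x) • c := by
  have h₁ : deriv (fun x : ℝ => x ^ 3 • c) = fun x => (3 * x ^ 2) • c := by
    funext x
    simpa using ((hasDerivAt_pow 3 x).smul_const c).deriv
  rw [iteratedDeriv_succ, iteratedDeriv_one, h₁]
  funext x
  have := (((hasDerivAt_pow 2 x).const_mul 3).smul_const c).deriv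
  simp only [Nat.cast_ofNat, Nat.add_one_sub_one, pow_one] at this
  rw [this, ← mul_assoc]
  norm_num

theorem lipQuotients_const_mul_smul (a : ℝ) (c : E) :
    lipQuotients (fun x : ℝ => (a * x) • c) = {|a| * ‖c‖} := by
  have hquot {x y : ℝ} (hxy : x ≠ y) :
      ‖(a * x) • c - (a * y) • c‖ / |x - y| = |a| * ‖c‖ := by
    have : |x - y| ≠ 0 := abs_ne_zero.2 (sub_ne_zero.2 hxy)
    rw [← sub_smul, ← mul_sub, norm_smul, Real.norm_eq_abs, abs_mul, mul_right_comm,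
      mul_div_cancel_right₀ _ this]
  ext r
  constructor
  · rintro ⟨x, y, hxy, rfl⟩
    exact hquot hxy
  · rintro rfl
    exact ⟨0, 1, zero_ne_one, (hquot zero_ne_one).symm⟩

theorem isC21_pow_three_smul (c : E) : IsC21 fun x : ℝ => x ^ 3 • c := by
  refine ⟨by fun_prop, ?_⟩
  rw [iteratedDeriv_two_pow_three_smul, lipQuotients_const_mul_smul]
  exact bddAbove_singleton

theorem lipNorm_iteratedDeriv_two_pow_three_smul (c : E) :
    lipNorm (iteratedDeriv 2 fun x : ℝ => x ^ 3 • c) = 6 * ‖c‖ := by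
  rw [lipNorm, iteratedDeriv_two_pow_three_smul, lipQuotients_const_mul_smul, csSup_singleton,
    abs_of_pos (by norm_num)]

end LipschitzConstant

section ScaledSummand

variable {E : Type*} [NormedAddCommGroup E] [NormedSpace ℝ E] {f : ℝ → E} {L : ℝ≥0}

theorem lipschitzWith_iteratedDeriv_two_comp_affine (hf : ContDiff ℝ 2 f)
    (hL : LipschitzWith L (iteratedDeriv 2 f)) (x a : ℝ) :
    LipschitzWith (L * ‖a‖₊ ^ 3) (iteratedDeriv 2 fun y => f (x + a * y)) := by
  have h : iteratedDeriv 2 (fun y => f (x + a * y)) =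
      fun y => a ^ 2 • iteratedDeriv 2 f (x + a * y) := by
    rw [iteratedDeriv_comp_const_smul (f := fun z => f (x + z))
      (hf.comp (contDiff_const.add contDiff_id)), iteratedDeriv_comp_const_add]
  rw [h]
  refine LipschitzWith.of_dist_le_mul fun y z => ?_
  calc dist (a ^ 2 • iteratedDeriv 2 f (x + a * y)) (a ^ 2 • iteratedDeriv 2 f (x + a * z))
      = |a| ^ 2 * dist (iteratedDeriv 2 f (x + a * y)) (iteratedDeriv 2 f (x + a * z)) := by
        rw [dist_smul₀, norm_pow, Real.norm_eq_abs]
    _ ≤ |a| ^ 2 * (L * dist (x + a * y) (x + a * z)) := by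
        gcongr
        exact hL.dist_le_mul _ _
    _ = ↑(L * ‖a‖₊ ^ 3) * dist y z := by
        rw [dist_add_left, Real.dist_eq, ← mul_sub, abs_mul, ← Real.dist_eq]
        push_cast
        rw [Real.norm_eq_abs]
        ring

variable [CompleteSpace E]

theorem norm_integral_map_const_mul_sub_le (hf : ContDiff ℝ 2 f)
    (hL : LipschitzWith L (iteratedDeriv 2 f)) {P : Measure ℝ} (hP : IsP3 P) (a x : ℝ) :
    ‖∫ y, f (x + y) ∂((standardize P).map (a * ·)) - ∫ y, f (x + y) ∂((symTwoPoint 1).map (a * ·))‖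
      ≤ L * |a| ^ 3 / 6 * B (rho P) := by
  have := hP.isProb
  have hmap (μ : Measure ℝ) : ∫ y, f (x + y) ∂(μ.map (a * ·)) = ∫ y, f (x + a * y) ∂μ :=
    integral_map (by fun_prop) (hf.continuous.comp (continuous_const_add x)).aestronglyMeasurable
  rw [hmap, hmap, ← integral_abs_pow_three_standardize]
  simpa using norm_integral_sub_integral_symTwoPoint_one_le
    (hf.comp (contDiff_const.add (contDiff_const.mul contDiff_id)))
    (lipschitzWith_iteratedDeriv_two_comp_affine hf hL x a) (memLp_id_standardize hP.memLp)
    (integral_id_standardize (hP.memLp.integrable (by norm_num)))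
    (integral_sq_standardize hP.sd_pos.ne')

end ScaledSummand

section StandardizedConvolution

variable {E : Type*} [NormedAddCommGroup E] [NormedSpace ℝ E] {f : ℝ → E} {n : ℕ}
  {P : Fin n → Measure ℝ}

theorem IsC21.integrable_standardize_convolution (hf : IsC21 f) (hP : ∀ i, IsP3 (P i)) :
    Integrable f (standardize (convolution P)) := by
  have (i : Fin n) := (hP i).isProb
  exact integrable_of_memLp_three hf.1 (lipschitzWith_toNNReal_lipNorm hf.2)
    (memLp_id_standardize (memLp_id_convolution fun i => (hP i).memLp))

theorem standardize_convolution_symTwoPoint {s : Fin n → ℝ} (hs : ∀ i, 0 < s i) :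
    standardize (convolution fun i => symTwoPoint (s i)) =
      convolution fun i => (symTwoPoint 1).map (s i / √(∑ j, s j ^ 2) * ·) := by
  have (i : Fin n) := isProbabilityMeasure_symTwoPoint (s i)
  rw [standardize_convolution
    (fun i => (isP3_symTwoPoint (hs i)).memLp.mono_exponent (by norm_num))
    fun i => (isP3_symTwoPoint (hs i)).sd_pos.ne']
  simp only [standardize_symTwoPoint (hs _), sd_symTwoPoint (hs _).le]

theorem standardize_convPow_symTwoPoint {s : ℝ} (hs : 0 < s) (n : ℕ) :
    standardize (convPow (symTwoPoint s) n) = standardize (symBinomial n) := by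
  have hp : (2⁻¹ : ℝ) ∈ Icc 0 1 := by norm_num
  have h01 : 0 < sd (twoPointLaw 2⁻¹ 0 1) := by
    rw [sd_twoPointLaw hp]
    norm_num
  have := isProbabilityMeasure_symTwoPoint s
  have := isProbabilityMeasure_twoPointLaw hp 0 1
  rw [symBinomial, half_smul_dirac_add_dirac,
    standardize_convPow ((isP3_symTwoPoint hs).memLp.mono_exponent (by norm_num))
      (isP3_symTwoPoint hs).sd_pos,
    standardize_convPow ((memLp_id_three_iff.2 (integrable_twoPointLaw _ _ _ _)).mono_exponent
      (by norm_num)) h01,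
    standardize_symTwoPoint hs, standardize_twoPointLaw_half one_pos]

theorem sum_const_pow_three_div (n : ℕ) {s : ℝ} (hs : 0 < s) (b : ℝ) :
    ∑ _i : Fin n, s ^ 3 / √(∑ _j : Fin n, s ^ 2) ^ 3 * b = b / √n := by
  obtain rfl | hn := n.eq_zero_or_pos
  · simp
  have hsqrt : √(n : ℝ) ≠ 0 := (Real.sqrt_pos.2 (Nat.cast_pos.2 hn)).ne'
  rw [Fin.sum_const, Fin.sum_const, nsmul_eq_mul, nsmul_eq_mul, Real.sqrt_mul n.cast_nonneg,
    Real.sqrt_sq hs.le, mul_pow]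
  calc (n : ℝ) * (s ^ 3 / (√n ^ 3 * s ^ 3) * b) = √n ^ 2 * (s ^ 3 / (√n ^ 3 * s ^ 3) * b) := by
        rw [Real.sq_sqrt n.cast_nonneg]
    _ = b / √n := by field_simp

variable [CompleteSpace E]

theorem IsC21.norm_integral_standardize_convolution_sub_le (hf : IsC21 f)
    (hP : ∀ i, IsP3 (P i)) :
    ‖∫ x, f x ∂(standardize (convolution P))
        - ∫ x, f x ∂(standardize (convolution fun i => symTwoPoint (sd (P i))))‖
      ≤ lipNorm (iteratedDeriv 2 f) / 6 *
          ∑ i, sd (P i) ^ 3 / √(∑ j, sd (P j) ^ 2) ^ 3 * B (rho (P i)) := by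
  have (i : Fin n) := (hP i).isProb
  have := isProbabilityMeasure_symTwoPoint 1
  have hL := lipschitzWith_toNNReal_lipNorm hf.2
  rw [standardize_convolution (fun i => (hP i).memLp.mono_exponent (by norm_num))
    fun i => (hP i).sd_pos.ne', standardize_convolution_symTwoPoint fun i => (hP i).sd_pos]
  set a : Fin n → ℝ := fun i => sd (P i) / √(∑ j, sd (P j) ^ 2)
  set P' : Fin n → Measure ℝ := fun i => (standardize (P i)).map (a i * ·)
  set Q' : Fin n → Measure ℝ := fun i => (symTwoPoint 1).map (a i * ·)
  have hP' (i : Fin n) : IsProbabilityMeasure (P' i) :=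
    Measure.isProbabilityMeasure_map (by fun_prop)
  have hQ' (i : Fin n) : IsProbabilityMeasure (Q' i) :=
    Measure.isProbabilityMeasure_map (by fun_prop)
  have hint (s : Finset (Fin n)) : Integrable f (convolution (s.piecewise Q' P')) := by
    have (i : Fin n) : IsProbabilityMeasure (s.piecewise Q' P' i) :=
      s.piecewise_cases Q' P' _ (hQ' i) (hP' i)
    exact integrable_of_memLp_three hf.1 hL <| memLp_id_convolution fun i =>
      s.piecewise_cases Q' P' (fun μ : Measure ℝ => MemLp id 3 μ)
        (memLp_id_map_const_mul (isP3_symTwoPoint one_pos).memLp _)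
        (memLp_id_map_const_mul (memLp_id_standardize (hP i).memLp) _)
  calc _ ≤ ∑ i, (lipNorm (iteratedDeriv 2 f)).toNNReal * |a i| ^ 3 / 6 * B (rho (P i)) :=
        norm_integral_convolution_sub_le hint fun i =>
          norm_integral_map_const_mul_sub_le hf.1 hL (hP i) (a i)
    _ = _ := by
        rw [Finset.mul_sum, Real.coe_toNNReal _ lipNorm_nonneg]
        refine Finset.sum_congr rfl fun i _ => ?_
        rw [abs_of_nonneg (div_nonneg (hP i).sd_pos.le (Real.sqrt_nonneg _)), div_pow]
        ring

theorem integral_pow_three_smul_standardize_convolution (hP : ∀ i, IsP3 (P i)) (c : E) :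
    ∫ x, x ^ 3 • c ∂(standardize (convolution P)) =
      ((∑ i, centredThird (P i)) / √(∑ i, sd (P i) ^ 2) ^ 3) • c := by
  have (i : Fin n) := (hP i).isProb
  rw [integral_smul_const, integral_pow_three_standardize,
    centredThird_convolution fun i => (hP i).memLp,
    sd_convolution fun i => (hP i).memLp.mono_exponent (by norm_num)]

theorem norm_integral_pow_three_smul_standardize_convolution_sub_eq (hP : ∀ i, IsP3 (P i))
    (htwo : ∀ i, IsTwoPoint (P i))
    (hsign : (∀ i, 0 ≤ centredThird (P i)) ∨ ∀ i, centredThird (P i) ≤ 0) (c : E) :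
    ‖∫ x, x ^ 3 • c ∂(standardize (convolution P))
        - ∫ x, x ^ 3 • c ∂(standardize (convolution fun i => symTwoPoint (sd (P i))))‖
      = lipNorm (iteratedDeriv 2 fun x : ℝ => x ^ 3 • c) / 6 *
          ∑ i, sd (P i) ^ 3 / √(∑ j, sd (P j) ^ 2) ^ 3 * B (rho (P i)) := by
  have habs : |∑ i, centredThird (P i)| = ∑ i, |centredThird (P i)| := by
    obtain h | h := hsign
    · rw [abs_of_nonneg (Finset.sum_nonneg fun i _ => h i)]
      exact Finset.sum_congr rfl fun i _ => (abs_of_nonneg (h i)).symm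
    · rw [abs_of_nonpos (Finset.sum_nonpos fun i _ => h i), ← Finset.sum_neg_distrib]
      exact Finset.sum_congr rfl fun i _ => (abs_of_nonpos (h i)).symm
  rw [integral_pow_three_smul_standardize_convolution hP,
    integral_pow_three_smul_standardize_convolution fun i => isP3_symTwoPoint (hP i).sd_pos,
    lipNorm_iteratedDeriv_two_pow_three_smul]
  simp only [centredThird_symTwoPoint, Finset.sum_const_zero, zero_div, zero_smul, sub_zero,
    div_mul_eq_mul_div, (htwo _).sd_pow_three_mul_B_rho]
  rw [norm_smul, Real.norm_eq_abs, abs_div, abs_of_nonneg (by positivity : 0 ≤ √_ ^ 3), habs,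
    ← Finset.sum_div]
  ring

end StandardizedConvolution

end RademacherApprox

open RademacherApprox in
theorem theorem1p2 {E : Type*} [NormedAddCommGroup E] [NormedSpace ℝ E] [CompleteSpace E]
    (n : ℕ) (hn : 1 ≤ n) :
    -- the inequality for general summands, including the existence of the integrals
    (∀ P : Fin n → Measure ℝ, (∀ i, IsP3 (P i)) → ∀ f : ℝ → E, IsC21 f →
      Integrable f (standardize (convolution P)) ∧
      Integrable f (standardize (convolution fun i => symTwoPoint (sd (P i)))) ∧
      ‖∫ x, f x ∂(standardize (convolution P))
          - ∫ x, f x ∂(standardize (convolution fun i => symTwoPoint (sd (P i))))‖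
        ≤ lipNorm (iteratedDeriv 2 f) / 6 *
            ∑ i, sd (P i) ^ 3 / √(∑ j, sd (P j) ^ 2) ^ 3 * B (rho (P i))) ∧
    -- the equality statement
    (∀ P : Fin n → Measure ℝ, (∀ i, IsP3 (P i)) → (∀ i, IsTwoPoint (P i)) →
      ((∀ i, 0 ≤ centredThird (P i)) ∨ (∀ i, centredThird (P i) ≤ 0)) →
      ∀ (c : E) (f : ℝ → E), (∀ x, f x = x ^ 3 • c) →
        IsC21 f ∧
        ‖∫ x, f x ∂(standardize (convolution P))
            - ∫ x, f x ∂(standardize (convolution fun i => symTwoPoint (sd (P i))))‖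
          = lipNorm (iteratedDeriv 2 f) / 6 *
              ∑ i, sd (P i) ^ 3 / √(∑ j, sd (P j) ^ 2) ^ 3 * B (rho (P i))) ∧
    -- in the homoscedastic case the comparison law is the standardized symmetric binomial law
    (∀ P : Fin n → Measure ℝ, (∀ i, IsP3 (P i)) → (∀ i j, sd (P i) = sd (P j)) →
      standardize (convolution fun i => symTwoPoint (sd (P i))) = standardize (symBinomial n)) ∧
    -- the i.i.d. case
    (∀ P : Measure ℝ, IsP3 P →
      (∑ _i : Fin n, sd P ^ 3 / √(∑ _j : Fin n, sd P ^ 2) ^ 3 * B (rho P) = B (rho P) / √n) ∧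
      (∀ f : ℝ → E, IsC21 f →
        Integrable f (standardize (convPow P n)) ∧
        Integrable f (standardize (symBinomial n)) ∧
        ‖∫ x, f x ∂(standardize (convPow P n)) - ∫ x, f x ∂(standardize (symBinomial n))‖
          ≤ B (rho P) / (6 * √n) * lipNorm (iteratedDeriv 2 f)) ∧
      (IsTwoPoint P → ∀ (c : E) (f : ℝ → E), (∀ x, f x = x ^ 3 • c) →
        ‖∫ x, f x ∂(standardize (convPow P n)) - ∫ x, f x ∂(standardize (symBinomial n))‖
          = B (rho P) / (6 * √n) * lipNorm (iteratedDeriv 2 f))) := by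
  refine ⟨fun P hP f hf => ⟨hf.integrable_standardize_convolution hP,
      hf.integrable_standardize_convolution fun i => isP3_symTwoPoint (hP i).sd_pos,
      hf.norm_integral_standardize_convolution_sub_le hP⟩,
    fun P hP htwo hsign c f hfc => ?_, fun P hP hsd => ?_, fun P hP => ?_⟩
  · obtain rfl : f = fun x => x ^ 3 • c := funext hfc
    exact ⟨isC21_pow_three_smul c,
      norm_integral_pow_three_smul_standardize_convolution_sub_eq hP htwo hsign c⟩
  · simp only [hsd _ ⟨0, hn⟩]
    exact standardize_convPow_symTwoPoint (hP _).sd_pos n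
  · have hsum := sum_const_pow_three_div n hP.sd_pos (B (rho P))
    have hbinomial := standardize_convPow_symTwoPoint hP.sd_pos n
    have hbound (f : ℝ → E) : B (rho P) / (6 * √n) * lipNorm (iteratedDeriv 2 f) =
        lipNorm (iteratedDeriv 2 f) / 6 *
          ∑ _i : Fin n, sd P ^ 3 / √(∑ _j : Fin n, sd P ^ 2) ^ 3 * B (rho P) := by
      rw [hsum]
      ring
    simp only [hbound, ← hbinomial]
    refine ⟨hsum, fun f hf => ⟨hf.integrable_standardize_convolution fun _ => hP,
      hf.integrable_standardize_convolution fun _ => isP3_symTwoPoint hP.sd_pos,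
      hf.norm_integral_standardize_convolution_sub_le fun _ => hP⟩, fun htwo c f hfc => ?_⟩
    obtain rfl : f = fun x => x ^ 3 • c := funext hfc
    exact norm_integral_pow_three_smul_standardize_convolution_sub_eq (fun _ => hP)
      (fun _ => htwo) ((le_total 0 (centredThird P)).imp (fun h _ => h) fun h _ => h) c
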